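/- Let $A=[A(i,j)]_{i,j=1}^N$ be an irreducible matrix with entries in $\{0,1\}$ that is not a permutation matrix. Let $X_A=\{(x_n)_{n\in\mathbb N}\in\{1,\dots,N\}^{\mathbb N} : A(x_n,x_{n+1})=1 \text{ for all } n\}$, with the relative topology of the product topology, and let $\sigma((x_n)_n)=(x_{n+1})_n$ be the shift on $X_A$. Let $G_A$ be the groupoid of all triples $(x,n,z)\in X_A\times\mathbb Z\times X_A$ for which there are integers $k,l\ge 0$ with $n=k-l$ and $\sigma^k(x)=\sigma^l(z)$; its operations are $(x,n,z)(z,m,w)=(x,n+m,w)$, $(x,n,z)^{-1}=(z,-n,x)$, $r(x,n,z)=(x,0,x)$, $s(x,n,z)=(z,0,z)$, and its topology is generated by the sets $\{(y,k-l,w) : y\in U,\ w\in V,\ \sigma^k(y)=\sigma^l(w)\}$, where $k,l\ge 0$ and $U,V\subset X_A$ are open sets such that $\sigma^k$ is injective on $U$ and $\sigma^l$ is injective on $V$. For a continuous function $f:X_A\to\mathbb Z$ put $f^n(x)=\sum_{i=0}^{n-1}f(\sigma^i(x))$ (so $f^0=0$), and let $$G_{A,f}=\{(x,n,z)\in X_A\times\mathbb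 Z\times X_A : \exists\, k,l\ge 0,\ n=k-l,\ \sigma^k(x)=\sigma^l(z),\ f^k(x)=f^l(z)\}.$$ Then, for every continuous $f:X_A\to\mathbb Z$, the set $G_{A,f}$ is an open and closed subgroupoid of $G_A$ and, with the relative topology, 1. $G_{A,f}$ is étale: it is a locally compact Hausdorff topological groupoid whose range map $r:G_{A,f}\to G_{A,f}$ is a local homeomorphism; 2. $G_{A,f}$ is essentially principal: the interior of the isotropy bundle $\{\gamma\in G_{A,f} : r(\gamma)=s(\gamma)\}$ in $G_{A,f}$ is the unit space $G_{A,f}^{(0)}=\{(x,0,x) : x\in X_A\}$; 3. $G_{A,f}$ is (topologically) amenable: there is a net $(m_i)$ of nonnegative continuous compactly supported functions on $G_{A,f}$ such that $\sum_{r(\eta)=u}m_i(\eta)\le 1$ for all units $u$, $\sum_{r(\eta)=u}m_i(\eta)\to 1$ uniformly for $u$ in compact subsets of $G_{A,f}^{(0)}$, and $\sum_{r(\eta)=r(\gamma)}|m_i(\gamma^{-1}\eta)-m_i(\eta)|\to 0$ uniformly for $\gamma$ in compact subsets of $G_{A,f}$. -/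

import Mathlib

open Set Filter Topology

universe u

/-! ## Groupoids as sets of arrows with a partially defined product -/

/-- A groupoid, given as its set `G` of arrows. The units are the arrows `γ` with `rng γ = γ`,
and `mul g h` is defined exactly when `src g = rng h`. -/
class ArrowGroupoid (G : Type u) where
  /-- the range map `r`, with values in the units -/
  rng : G → G
  /-- the source map `s`, with values in the units -/
  src : G → G
  /-- the inverse -/
  inv : G → G
  /-- the product of a composable pair -/
  mul : (g h : G) → src g = rng h → G
  rng_rng : ∀ g, rng (rng g) = rng g
  src_rng : ∀ g, src (rng g) = rng g
  rng_src : ∀ g, rng (src g) = src g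
  src_src : ∀ g, src (src g) = src g
  rng_inv : ∀ g, rng (inv g) = src g
  src_inv : ∀ g, src (inv g) = rng g
  rng_mul : ∀ g h e, rng (mul g h e) = rng g
  src_mul : ∀ g h e, src (mul g h e) = src h
  mul_assoc : ∀ g h k (e : src g = rng h) (e' : src h = rng k),
    mul (mul g h e) k ((src_mul g h e).trans e') =
      mul g (mul h k e') (e.trans (rng_mul h k e').symm)
  rng_mul_self : ∀ g, mul (rng g) g (src_rng g) = g
  mul_src_self : ∀ g, mul g (src g) (rng_src g).symm = g
  mul_inv_self : ∀ g, mul g (inv g) (rng_inv g).symm = rng g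
  inv_mul_self : ∀ g, mul (inv g) g (src_inv g) = src g

namespace ArrowGroupoid

/-- The unit space `G⁽⁰⁾`. -/
def units (G : Type u) [ArrowGroupoid G] : Set G := {γ | rng γ = γ}

/-- The isotropy bundle `G' = {γ | r γ = s γ}`. -/
def isotropy (G : Type u) [ArrowGroupoid G] : Set G := {γ | rng γ = src γ}

/-- A subgroupoid: a set of arrows closed under products and inverses
(hence also under range and source, as `r γ = γ γ⁻¹` and `s γ = γ⁻¹ γ`). -/
structure Sub (G : Type u) [ArrowGroupoid G] where
  carrier : Set G
  inv_mem : ∀ {g}, g ∈ carrier → inv g ∈ carrier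
  mul_mem : ∀ {g h} (e : src g = rng h), g ∈ carrier → h ∈ carrier → mul g h e ∈ carrier

theorem Sub.rng_mem {G : Type u} [ArrowGroupoid G] (H : Sub G) {g : G} (hg : g ∈ H.carrier) :
    rng g ∈ H.carrier := by
  have h := H.mul_mem (rng_inv g).symm hg (H.inv_mem hg)
  rwa [mul_inv_self] at h

theorem Sub.src_mem {G : Type u} [ArrowGroupoid G] (H : Sub G) {g : G} (hg : g ∈ H.carrier) :
    src g ∈ H.carrier := by
  have h := H.mul_mem (src_inv g) (H.inv_mem hg) hg
  rwa [inv_mul_self] at h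

/-- A subgroupoid is a groupoid under the inherited operations. As a topological space,
`↥H.carrier` carries the relative topology (the subtype instance). -/
instance Sub.arrowGroupoid {G : Type u} [ArrowGroupoid G] (H : Sub G) :
    ArrowGroupoid H.carrier where
  rng g := ⟨rng g.1, H.rng_mem g.2⟩
  src g := ⟨src g.1, H.src_mem g.2⟩
  inv g := ⟨inv g.1, H.inv_mem g.2⟩
  mul g h e := ⟨mul g.1 h.1 (congrArg Subtype.val e),
    H.mul_mem (congrArg Subtype.val e) g.2 h.2⟩
  rng_rng g := Subtype.ext (rng_rng g.1)
  src_rng g := Subtype.ext (src_rng g.1)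
  rng_src g := Subtype.ext (rng_src g.1)
  src_src g := Subtype.ext (src_src g.1)
  rng_inv g := Subtype.ext (rng_inv g.1)
  src_inv g := Subtype.ext (src_inv g.1)
  rng_mul g h e := Subtype.ext (rng_mul g.1 h.1 (congrArg Subtype.val e))
  src_mul g h e := Subtype.ext (src_mul g.1 h.1 (congrArg Subtype.val e))
  mul_assoc g h k e e' := Subtype.ext
    (mul_assoc g.1 h.1 k.1 (congrArg Subtype.val e) (congrArg Subtype.val e'))
  rng_mul_self g := Subtype.ext (rng_mul_self g.1)
  mul_src_self g := Subtype.ext (mul_src_self g.1)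
  mul_inv_self g := Subtype.ext (mul_inv_self g.1)
  inv_mul_self g := Subtype.ext (inv_mul_self g.1)

/-- An étale groupoid: a locally compact Hausdorff topological groupoid whose range map,
as a map from `G` to `G`, is a local homeomorphism. -/
structure IsEtale (G : Type u) [ArrowGroupoid G] [TopologicalSpace G] : Prop where
  t2 : T2Space G
  locallyCompact : LocallyCompactSpace G
  continuous_inv : Continuous (inv : G → G)
  continuous_mul : Continuous
    (fun p : {p : G × G // src p.1 = rng p.2} ↦ mul p.1.1 p.1.2 p.2)
  isLocalHomeomorph_rng : IsLocalHomeomorph (rng : G → G)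

/-- `G` is essentially principal: the interior of the isotropy bundle is the unit space. -/
def IsEssentiallyPrincipal (G : Type u) [ArrowGroupoid G] [TopologicalSpace G] : Prop :=
  interior (isotropy G) = units G

/-- (Topological) amenability of an étale groupoid: there is a net `(m i)` of nonnegative
functions in `C_c(G)` with `∑_{r η = u} m i η ≤ 1` for all units `u`, such that
`∑_{r η = u} m i η → 1` uniformly on compact subsets of the unit space and
`∑_{r η = r γ} |m i (γ⁻¹ η) - m i η| → 0` uniformly on compact subsets of `G`.
(In an étale groupoid the fibres of `r` are closed and discrete, so for functions of compact
support these are finite sums.) -/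
def IsAmenable (G : Type u) [ArrowGroupoid G] [TopologicalSpace G] : Prop :=
  ∃ (ι : Type u) (_ : Preorder ι) (_ : IsDirectedOrder ι) (_ : Nonempty ι) (m : ι → G → ℝ),
    (∀ i, Continuous (m i) ∧ HasCompactSupport (m i) ∧ ∀ γ, 0 ≤ m i γ) ∧
    (∀ i, ∀ v ∈ units G, ∑' η : {η : G // rng η = v}, m i η.1 ≤ 1) ∧
    (∀ K : Set G, K ⊆ units G → IsCompact K →
      TendstoUniformlyOn (fun i v ↦ ∑' η : {η : G // rng η = v}, m i η.1)
        (fun _ ↦ 1) atTop K) ∧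
    (∀ K : Set G, IsCompact K →
      TendstoUniformlyOn
        (fun i γ ↦ ∑' η : {η : G // rng η = rng γ},
          |m i (mul (inv γ) η.1 ((src_inv γ).trans η.2.symm)) - m i η.1|)
        (fun _ ↦ 0) atTop K)

end ArrowGroupoid

/-! ## One-sided topological Markov shifts and their groupoids -/

/-- The shift space `X_A`, with the relative topology of the product topology. -/
abbrev MarkovShift {N : ℕ} (A : Matrix (Fin N) (Fin N) ℤ) : Type :=
  {x : ℕ → Fin N // ∀ n, A (x n) (x (n + 1)) = 1}

namespace MarkovShift

variable {N : ℕ} {A : Matrix (Fin N) (Fin N) ℤ}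

/-- The shift transformation `σ_A`. -/
def shift (x : MarkovShift A) : MarkovShift A :=
  ⟨fun n ↦ x.1 (n + 1), fun n ↦ x.2 (n + 1)⟩

/-- `f^n(x) = ∑_{i < n} f(σ_A^i(x))`. -/
def cocycleSum (f : C(MarkovShift A, ℤ)) (n : ℕ) (x : MarkovShift A) : ℤ :=
  ∑ i ∈ Finset.range n, f (shift^[i] x)

theorem cocycleSum_add (f : C(MarkovShift A, ℤ)) (n k : ℕ) (x : MarkovShift A) :
    cocycleSum f (n + k) x = cocycleSum f n x + cocycleSum f k (shift^[n] x) := by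
  unfold cocycleSum
  rw [Finset.sum_range_add]
  congr 1
  refine Finset.sum_congr rfl fun i _ ↦ ?_
  rw [← Function.iterate_add_apply, add_comm n i]

/-- If `σ^k x = σ^l z` and `σ^p z = σ^q w`, then `σ^(k+p) x = σ^(q+l) w`. -/
theorem shift_trans {x z w : MarkovShift A} {k l p q : ℕ}
    (h : shift^[k] x = shift^[l] z) (h' : shift^[p] z = shift^[q] w) :
    shift^[k + p] x = shift^[q + l] w := by
  rw [add_comm k p, Function.iterate_add_apply, h, ← Function.iterate_add_apply, add_comm p l,
    Function.iterate_add_apply, h', ← Function.iterate_add_apply, add_comm l q]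

end MarkovShift

open MarkovShift

/-- The groupoid `G_A` of triples `(x, n, z)` such that `n = k - l` and `σ^k x = σ^l z` for some
`k, l ≥ 0`. It is a structure, rather than a subtype of `X_A × ℤ × X_A`, because its topology is
not the relative one. -/
@[ext]
structure MarkovGroupoid {N : ℕ} (A : Matrix (Fin N) (Fin N) ℤ) : Type where
  x : MarkovShift A
  n : ℤ
  z : MarkovShift A
  tail : ∃ k l : ℕ, n = (k : ℤ) - l ∧ shift^[k] x = shift^[l] z

namespace MarkovGroupoid

variable {N : ℕ} {A : Matrix (Fin N) (Fin N) ℤ}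

/-- The unit `(x, 0, x)`. -/
def unit (x : MarkovShift A) : MarkovGroupoid A := ⟨x, 0, x, 0, 0, by simp, rfl⟩

/-- The range of `(x, n, z)` is `(x, 0, x)`, its source is `(z, 0, z)`, its inverse is
`(z, -n, x)`, and `(x, n, z) (z, m, w) = (x, n + m, w)`. -/
instance : ArrowGroupoid (MarkovGroupoid A) where
  rng g := unit g.x
  src g := unit g.z
  inv g := ⟨g.z, -g.n, g.x, by
    obtain ⟨k, l, hn, h⟩ := g.tail
    exact ⟨l, k, by omega, h.symm⟩⟩
  mul g h e := ⟨g.x, g.n + h.n, h.z, by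
    have e' : g.z = h.x := congrArg MarkovGroupoid.x e
    obtain ⟨k, l, hn, hg⟩ := g.tail
    obtain ⟨p, q, hm, hh⟩ := h.tail
    rw [← e'] at hh
    exact ⟨k + p, q + l, by push_cast; omega, shift_trans hg hh⟩⟩
  rng_rng _ := rfl
  src_rng _ := rfl
  rng_src _ := rfl
  src_src _ := rfl
  rng_inv _ := rfl
  src_inv _ := rfl
  rng_mul _ _ _ := rfl
  src_mul _ _ _ := rfl
  mul_assoc g h k _ _ := MarkovGroupoid.ext rfl (add_assoc g.n h.n k.n) rfl
  rng_mul_self g := MarkovGroupoid.ext rfl (zero_add g.n) rfl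
  mul_src_self g := MarkovGroupoid.ext rfl (add_zero g.n) rfl
  mul_inv_self g := MarkovGroupoid.ext rfl (add_neg_cancel g.n) rfl
  inv_mul_self g := MarkovGroupoid.ext rfl (neg_add_cancel g.n) rfl

/-- The set `𝒰(U, k, l, V)` of all `(y, k - l, w)` in `G_A` with `y ∈ U`, `w ∈ V` and
`σ^k y = σ^l w`. -/
def basicOpen (U : Set (MarkovShift A)) (k l : ℕ) (V : Set (MarkovShift A)) :
    Set (MarkovGroupoid A) :=
  {g | g.x ∈ U ∧ g.z ∈ V ∧ g.n = (k : ℤ) - l ∧ shift^[k] g.x = shift^[l] g.z}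

/-- The topology of `G_A`, generated by the sets `𝒰(U, k, l, V)` with `U`, `V` open, `σ^k`
injective on `U` and `σ^l` injective on `V`. -/
instance : TopologicalSpace (MarkovGroupoid A) :=
  TopologicalSpace.generateFrom
    {S | ∃ (U V : Set (MarkovShift A)) (k l : ℕ), IsOpen U ∧ IsOpen V ∧
      InjOn (shift^[k]) U ∧ InjOn (shift^[l]) V ∧ S = basicOpen U k l V}

end MarkovGroupoid

/-- The cocycle groupoid `G_{A,f}` for `f`, as a subgroupoid of `G_A`: the triples `(x, n, z)` such
that `n = k - l`, `σ^k x = σ^l z` and `f^k(x) = f^l(z)` for some `k, l ≥ 0`. -/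
def cocycleGroupoid {N : ℕ} (A : Matrix (Fin N) (Fin N) ℤ) (f : C(MarkovShift A, ℤ)) :
    ArrowGroupoid.Sub (MarkovGroupoid A) where
  carrier := {g | ∃ k l : ℕ, g.n = (k : ℤ) - l ∧ shift^[k] g.x = shift^[l] g.z ∧
    cocycleSum f k g.x = cocycleSum f l g.z}
  inv_mem := by
    rintro g ⟨k, l, hn, h, hf⟩
    refine ⟨l, k, ?_, h.symm, hf.symm⟩
    change -g.n = _
    omega
  mul_mem := by
    rintro g h e ⟨k, l, hn, hg, hf⟩ ⟨p, q, hm, hh, hf'⟩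
    have e' : g.z = h.x := congrArg MarkovGroupoid.x e
    rw [← e'] at hh hf'
    refine ⟨k + p, q + l, ?_, shift_trans hg hh, ?_⟩
    · change g.n + h.n = _
      push_cast
      omega
    · change cocycleSum f (k + p) g.x = cocycleSum f (q + l) h.z
      rw [cocycleSum_add, cocycleSum_add, hf, hg, ← cocycleSum_add, ← hh, ← hf',
        ← cocycleSum_add, add_comm]

/-! For fixed `k` and `l`, the arrows `(x, k - l, z)` with `σ^k x = σ^l z` form a compact open set,
`piece A k l`, topologised by the pair `(x, z)` (`nhds_eq`). There, belonging to `G_{A,f}` means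
`f^k(x) = f^l(z)`, whichever `k, l` represent the arrow (`mem_cocycleGroupoid_iff`). This condition
is locally constant, so `G_{A,f}` is clopen. Étaleness and essential principality pass from `G_A` to
open subgroupoids. For `G_A`, the latter holds because `X_A` has no isolated points, which prevents
`σ^k` and `σ^l` from agreeing on a nonempty open set when `k ≠ l`.

For amenability, attach to each `x` a sequence of arrows of `G_{A,f}` with range `x`: the `k`-th one
has a source that depends only on `(σ^k x, f^k(x))`. That source is `μ σ^k(x)`, where `μ` is the
first word, in a fixed enumeration, for which this point exists and has `f^{|μ|}` equal to `f^k(x)`;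
clopenness makes the choice continuous (`continuous_relift`). An arrow `γ` from `z` to `x` in `piece
A p q` carries the sequence at `z` to the one at `x` up to a shift of indices (`mul_reliftArrow`).
Hence the averages of the first `n + 1` indicators have mass 1 on each fibre, and translation by `γ`
moves them by at most `2(p + q)/(n + 1)` in `ℓ¹`; on a compact set `p + q` can be chosen bounded. -/

namespace MarkovShift

variable {N : ℕ} {A : Matrix (Fin N) (Fin N) ℤ}

/-! ### Cylinders and the shift map -/

/-- The sequences whose first `n` entries agree with those of `x`. -/
def cyl (n : ℕ) (x : MarkovShift A) : Set (MarkovShift A) := {y | ∀ i < n, y.1 i = x.1 i}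

theorem mem_cyl_self (n : ℕ) (x : MarkovShift A) : x ∈ cyl n x := fun _ _ ↦ rfl

theorem continuous_coord (i : ℕ) : Continuous fun x : MarkovShift A ↦ x.1 i :=
  (continuous_apply i).comp continuous_subtype_val

theorem isOpen_cyl (n : ℕ) (x : MarkovShift A) : IsOpen (cyl n x) := by
  have : cyl n x = ⋂ i ∈ Finset.range n, (fun y : MarkovShift A ↦ y.1 i) ⁻¹' {x.1 i} := by
    ext y
    simp [cyl]
  rw [this]
  exact isOpen_biInter_finset fun i _ ↦ (isOpen_discrete _).preimage (continuous_coord i)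

theorem cyl_mem_nhds (n : ℕ) (x : MarkovShift A) : cyl n x ∈ 𝓝 x :=
  (isOpen_cyl n x).mem_nhds (mem_cyl_self n x)

theorem exists_cyl_subset {x : MarkovShift A} {S : Set (MarkovShift A)} (hS : S ∈ 𝓝 x) :
    ∃ n, cyl n x ⊆ S := by
  rw [nhds_subtype_eq_comap, mem_comap] at hS
  obtain ⟨T, hT, hTS⟩ := hS
  obtain ⟨_, ⟨y, n, rfl⟩, hx, hn⟩ :=
    (PiNat.isTopologicalBasis_cylinders (fun _ : ℕ ↦ Fin N)).mem_nhds_iff.1 hT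
  rw [PiNat.mem_cylinder_iff_eq] at hx
  refine ⟨n, fun z hz ↦ hTS (hn ?_)⟩
  rw [← hx]
  exact hz

theorem shift_iterate_coord (k : ℕ) (x : MarkovShift A) (i : ℕ) :
    (shift^[k] x).1 i = x.1 (i + k) := by
  induction k generalizing x with
  | zero => rfl
  | succ k ih =>
    rw [Function.iterate_succ_apply, ih]
    change x.1 (i + k + 1) = _
    rw [add_assoc]

theorem continuous_shift : Continuous (shift : MarkovShift A → MarkovShift A) :=
  Continuous.subtype_mk (continuous_pi fun i ↦ continuous_coord (i + 1)) _

theorem continuous_shift_iterate (k : ℕ) :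
    Continuous (shift^[k] : MarkovShift A → MarkovShift A) :=
  continuous_shift.iterate k

theorem isClosed_range_val :
    IsClosed {x : ℕ → Fin N | ∀ n, A (x n) (x (n + 1)) = 1} := by
  simp only [ofPred_forall]
  refine isClosed_iInter fun n ↦ ?_
  have h : Continuous fun x : ℕ → Fin N ↦ (x n, x (n + 1)) := by fun_prop
  have h' : Continuous fun p : Fin N × Fin N ↦ A p.1 p.2 := continuous_of_discreteTopology
  exact isClosed_eq (h'.comp h) continuous_const

instance : CompactSpace (MarkovShift A) :=
  isCompact_iff_compactSpace.1 isClosed_range_val.isCompact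

/-- The point `i x`, when `i → x 0` is allowed. -/
def cons (i : Fin N) (x : MarkovShift A) (h : A i (x.1 0) = 1) : MarkovShift A :=
  ⟨fun n ↦ Nat.casesOn n i x.1, fun n ↦ by
    cases n with
    | zero => exact h
    | succ n => exact x.2 n⟩

theorem isOpenMap_shift : IsOpenMap (shift : MarkovShift A → MarkovShift A) := by
  rw [isOpenMap_iff_nhds_le]
  intro x S hS
  obtain ⟨n, hn⟩ := exists_cyl_subset hS
  -- Length `n + 1` fixes `y 0 = x 1` even when `n = 0`, so that `x 0` may be prepended to `y`.
  filter_upwards [cyl_mem_nhds (n + 1) (shift x)] with y hy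
  have h0 : A (x.1 0) (y.1 0) = 1 := by
    rw [hy 0 (by omega)]
    exact x.2 0
  have := hn (a := cons (x.1 0) y h0) fun i hi ↦ by
    cases i with
    | zero => rfl
    | succ i => exact hy i (by omega)
  exact this

theorem isOpenMap_shift_iterate (k : ℕ) :
    IsOpenMap (shift^[k] : MarkovShift A → MarkovShift A) := by
  induction k with
  | zero => exact IsOpenMap.id
  | succ k ih => exact ih.comp isOpenMap_shift

theorem eq_of_shift_iterate_eq {k : ℕ} {x y : MarkovShift A} (h : ∀ i < k, x.1 i = y.1 i)
    (h' : shift^[k] x = shift^[k] y) : x = y := by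
  refine Subtype.ext (funext fun i ↦ ?_)
  rcases lt_or_ge i k with hi | hi
  · exact h i hi
  · have := congrArg (fun z ↦ z.1 (i - k)) h'
    simpa only [shift_iterate_coord, Nat.sub_add_cancel hi] using this

theorem injOn_shift_iterate_cyl (k : ℕ) (x : MarkovShift A) : InjOn (shift^[k]) (cyl k x) :=
  fun _ hy _ hz h ↦ eq_of_shift_iterate_eq (fun i hi ↦ (hy i hi).trans (hz i hi).symm) h

theorem continuous_cocycleSum (f : C(MarkovShift A, ℤ)) (n : ℕ) : Continuous (cocycleSum f n) :=
  continuous_finsetSum _ fun i _ ↦ f.continuous.comp (continuous_shift_iterate i)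

end MarkovShift

/-! ### The topology of `G_A` -/

namespace MarkovGroupoid

variable {N : ℕ} {A : Matrix (Fin N) (Fin N) ℤ}

/-- The injectivity conditions on the generators cost nothing: `σ^k` is injective on cylinders of
length `k`, and `U` and `V` can be cut down to such cylinders. -/
theorem isOpen_basicOpen {U V : Set (MarkovShift A)} (hU : IsOpen U) (hV : IsOpen V) (k l : ℕ) :
    IsOpen (basicOpen U k l V) := by
  rw [isOpen_iff_forall_mem_open]
  intro g hg
  refine ⟨basicOpen (U ∩ cyl k g.x) k l (V ∩ cyl l g.z),
    fun h hh ↦ ⟨hh.1.1, hh.2.1.1, hh.2.2⟩, ?_,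
    ⟨⟨hg.1, mem_cyl_self _ _⟩, ⟨hg.2.1, mem_cyl_self _ _⟩, hg.2.2⟩⟩
  exact TopologicalSpace.isOpen_generateFrom_of_mem ⟨_, _, k, l, hU.inter (isOpen_cyl _ _),
    hV.inter (isOpen_cyl _ _), (injOn_shift_iterate_cyl _ _).mono inter_subset_right,
    (injOn_shift_iterate_cyl _ _).mono inter_subset_right, rfl⟩

/-- The compact open set of all `(x, k - l, z)` with `σ^k x = σ^l z`. -/
def piece (A : Matrix (Fin N) (Fin N) ℤ) (k l : ℕ) : Set (MarkovGroupoid A) :=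
  {g | g.n = (k : ℤ) - l ∧ shift^[k] g.x = shift^[l] g.z}

theorem basicOpen_univ (k l : ℕ) : basicOpen univ k l univ = piece A k l := by
  ext g
  simp [basicOpen, piece]

theorem isOpen_piece (k l : ℕ) : IsOpen (piece A k l) :=
  basicOpen_univ (A := A) k l ▸ isOpen_basicOpen isOpen_univ isOpen_univ k l

theorem exists_mem_piece (g : MarkovGroupoid A) : ∃ k l, g ∈ piece A k l := g.tail

theorem continuous_x : Continuous (x : MarkovGroupoid A → MarkovShift A) := by
  refine ⟨fun U hU ↦ ?_⟩
  have : x ⁻¹' U = ⋃ (k : ℕ) (l : ℕ), basicOpen (A := A) U k l univ := by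
    ext g
    simp only [mem_preimage, mem_iUnion]
    exact ⟨fun h ↦ let ⟨k, l, hg⟩ := exists_mem_piece g; ⟨k, l, h, trivial, hg⟩,
      fun ⟨_, _, h⟩ ↦ h.1⟩
  rw [this]
  exact isOpen_iUnion fun k ↦ isOpen_iUnion fun l ↦ isOpen_basicOpen hU isOpen_univ k l

theorem continuous_z : Continuous (z : MarkovGroupoid A → MarkovShift A) := by
  refine ⟨fun U hU ↦ ?_⟩
  have : z ⁻¹' U = ⋃ (k : ℕ) (l : ℕ), basicOpen (A := A) univ k l U := by
    ext g
    simp only [mem_preimage, mem_iUnion]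
    exact ⟨fun h ↦ let ⟨k, l, hg⟩ := exists_mem_piece g; ⟨k, l, trivial, h, hg⟩,
      fun ⟨_, _, h⟩ ↦ h.2.1⟩
  rw [this]
  exact isOpen_iUnion fun k ↦ isOpen_iUnion fun l ↦ isOpen_basicOpen isOpen_univ hU k l

theorem continuous_n : Continuous (n : MarkovGroupoid A → ℤ) := by
  refine continuous_discrete_rng.2 fun b ↦ ?_
  have : n ⁻¹' {b} = ⋃ (k : ℕ) (l : ℕ) (_ : (k : ℤ) - l = b), piece A k l := by
    ext g
    simp only [mem_preimage, mem_iUnion, mem_singleton_iff]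
    exact ⟨fun h ↦ let ⟨k, l, hg⟩ := exists_mem_piece g; ⟨k, l, hg.1 ▸ h, hg⟩,
      fun ⟨_, _, h, h'⟩ ↦ h'.1.trans h⟩
  rw [this]
  exact isOpen_iUnion fun k ↦ isOpen_iUnion fun l ↦ isOpen_iUnion fun _ ↦ isOpen_piece k l

/-- On `piece A k l`, the topology is that of the pairs `(x, z)`. -/
theorem nhds_eq {g : MarkovGroupoid A} {k l : ℕ} (hg : g ∈ piece A k l) :
    𝓝 g = 𝓟 (piece A k l) ⊓ comap (fun h ↦ (h.x, h.z)) (𝓝 (g.x, g.z)) := by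
  apply le_antisymm
  · exact le_inf (le_principal_iff.2 ((isOpen_piece k l).mem_nhds hg))
      (continuous_x.prodMk continuous_z).continuousAt.tendsto.le_comap
  · rw [TopologicalSpace.nhds_generateFrom (a := g)]
    refine le_iInf₂ fun S ⟨hgS, U, V, k', l', hU, hV, _, _, hS⟩ ↦ le_principal_iff.2 ?_
    subst hS
    have hx : {h : MarkovGroupoid A | h.x ∈ U ∩ cyl k g.x ∧ h.z ∈ V ∩ cyl l g.z} ∈
        comap (fun h ↦ (h.x, h.z)) (𝓝 (g.x, g.z)) :=
      preimage_mem_comap (prod_mem_nhds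
        (inter_mem (hU.mem_nhds hgS.1) (cyl_mem_nhds k g.x))
        (inter_mem (hV.mem_nhds hgS.2.1) (cyl_mem_nhds l g.z)))
    filter_upwards [mem_inf_of_left (mem_principal_self (piece A k l)), mem_inf_of_right hx]
      with h hh hh'
    have hkl : (k : ℤ) - l = k' - l' := hg.1.symm.trans hgS.2.2.1
    refine ⟨hh'.1.1, hh'.2.1, hh.1.trans hkl, ?_⟩
    -- Coordinates with `i + k' ≥ k` are governed by `σ^k h.x = σ^l h.z`. The others lie inside the
    -- cylinders, where `h` agrees with `g`.
    refine Subtype.ext (funext fun i ↦ ?_)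
    have h1 := congrArg (fun y ↦ y.1 (i + k' - k)) hh.2
    have h2 := congrArg (fun y ↦ y.1 i) hgS.2.2.2
    simp only [shift_iterate_coord] at h1 h2 ⊢
    rcases lt_or_ge (i + k') k with hi | hi
    · rw [hh'.1.2 _ hi, hh'.2.2 _ (by omega), h2]
    · rwa [Nat.sub_add_cancel hi, show i + k' - k + l = i + l' by omega] at h1

theorem tendsto_nhds_iff {α : Type*} {F : Filter α} {u : α → MarkovGroupoid A}
    {g : MarkovGroupoid A} {k l : ℕ} (hg : g ∈ piece A k l) :
    Tendsto u F (𝓝 g) ↔ (∀ᶠ a in F, u a ∈ piece A k l) ∧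
      Tendsto (fun a ↦ (u a).x) F (𝓝 g.x) ∧ Tendsto (fun a ↦ (u a).z) F (𝓝 g.z) := by
  rw [nhds_eq hg, tendsto_inf, tendsto_principal, tendsto_comap_iff, nhds_prod_eq,
    tendsto_prod_iff']
  rfl

instance : T2Space (MarkovGroupoid A) :=
  .of_injective_continuous (f := fun g : MarkovGroupoid A ↦ (g.x, g.n, g.z))
    (fun g h e ↦ by
      simp only [Prod.mk.injEq] at e
      exact MarkovGroupoid.ext e.1 e.2.1 e.2.2)
    (continuous_x.prodMk (continuous_n.prodMk continuous_z))

/-- A continuous image of the closed set of pairs with `σ^k x = σ^l z` in the compact space `X_A ×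
X_A`. -/
theorem isCompact_piece (k l : ℕ) : IsCompact (piece A k l) := by
  let C : Set (MarkovShift A × MarkovShift A) := {p | shift^[k] p.1 = shift^[l] p.2}
  have hC : IsClosed C := isClosed_eq ((continuous_shift_iterate k).comp continuous_fst)
    ((continuous_shift_iterate l).comp continuous_snd)
  have : CompactSpace C := isCompact_iff_compactSpace.1 hC.isCompact
  let u : C → MarkovGroupoid A := fun p ↦ ⟨p.1.1, (k : ℤ) - l, p.1.2, k, l, rfl, p.2⟩
  have hu : Continuous u := by
    refine continuous_iff_continuousAt.2 fun p ↦ ?_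
    refine (tendsto_nhds_iff (g := u p) (k := k) (l := l) ⟨rfl, p.2⟩).2
      ⟨Eventually.of_forall fun q ↦ ⟨rfl, q.2⟩, ?_, ?_⟩
    · exact (continuous_fst.comp continuous_subtype_val).continuousAt
    · exact (continuous_snd.comp continuous_subtype_val).continuousAt
  convert isCompact_range hu
  ext g
  constructor
  · intro hg
    exact ⟨⟨(g.x, g.z), hg.2⟩, MarkovGroupoid.ext rfl hg.1.symm rfl⟩
  · rintro ⟨p, rfl⟩
    exact ⟨rfl, p.2⟩

instance : LocallyCompactSpace (MarkovGroupoid A) := by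
  have : WeaklyLocallyCompactSpace (MarkovGroupoid A) := ⟨fun g ↦
    let ⟨k, l, hg⟩ := exists_mem_piece g
    ⟨_, isCompact_piece k l, (isOpen_piece k l).mem_nhds hg⟩⟩
  infer_instance

/-- Openness comes from that of `σ^l`: for `y` near `x`, the point `σ^k y` still has a preimage
under `σ^l` near `z`. Injectivity holds once `z` is confined to a cylinder of length `l`, since `σ^l
z = σ^k x` then determines `z`. -/
theorem isLocalHomeomorph_x :
    IsLocalHomeomorph (x : MarkovGroupoid A → MarkovShift A) := by
  have hopen : IsOpenMap (x : MarkovGroupoid A → MarkovShift A) := by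
    rw [isOpenMap_iff_nhds_le]
    intro g S hS
    obtain ⟨k, l, hg⟩ := exists_mem_piece g
    rw [mem_map, nhds_eq hg, inf_comm, mem_inf_principal, mem_comap] at hS
    obtain ⟨T, hT, hTS⟩ := hS
    obtain ⟨U, hU, V, hV, hUV⟩ := mem_nhds_prod_iff.1 hT
    have hV' : shift^[l] '' V ∈ 𝓝 (shift^[k] g.x) :=
      hg.2 ▸ (isOpenMap_shift_iterate l).image_mem_nhds hV
    filter_upwards [hU, (continuous_shift_iterate k).continuousAt hV'] with y hy hy'
    obtain ⟨w, hw, e⟩ := hy'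
    exact hTS (a := ⟨y, (k : ℤ) - l, w, k, l, rfl, e.symm⟩) (hUV ⟨hy, hw⟩) ⟨rfl, e.symm⟩
  rw [isLocalHomeomorph_iff_isOpenEmbedding_restrict]
  intro g
  obtain ⟨k, l, hg⟩ := exists_mem_piece g
  have hO := isOpen_basicOpen (A := A) isOpen_univ (isOpen_cyl l g.z) k l
  refine ⟨_, hO.mem_nhds ⟨trivial, mem_cyl_self _ _, hg⟩,
    .of_continuous_injective_isOpenMap (continuous_x.comp continuous_subtype_val) ?_
      (hopen.comp hO.isOpenMap_subtype_val)⟩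
  rintro ⟨a, ha⟩ ⟨b, hb⟩ (e : a.x = b.x)
  refine Subtype.ext (MarkovGroupoid.ext e (ha.2.2.1.trans hb.2.2.1.symm) ?_)
  refine injOn_shift_iterate_cyl l g.z ha.2.1 hb.2.1 ?_
  rw [← ha.2.2.2, ← hb.2.2.2, e]

theorem continuous_unit : Continuous (unit : MarkovShift A → MarkovGroupoid A) :=
  continuous_iff_continuousAt.2 fun x ↦
    (tendsto_nhds_iff (g := unit x) (k := 0) (l := 0) ⟨by simp [unit], rfl⟩).2
      ⟨Eventually.of_forall fun y ↦ ⟨by simp [unit], rfl⟩, tendsto_id, tendsto_id⟩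

/-- A continuous section of a local homeomorphism is a local homeomorphism. -/
theorem isLocalHomeomorph_unit : IsLocalHomeomorph (unit : MarkovShift A → MarkovGroupoid A) :=
  IsLocalHomeomorph.of_comp (g := x) (Homeomorph.refl _).isOpenEmbedding.isLocalHomeomorph isLocalHomeomorph_x continuous_unit

theorem isLocalHomeomorph_rng :
    IsLocalHomeomorph (ArrowGroupoid.rng : MarkovGroupoid A → MarkovGroupoid A) :=
  isLocalHomeomorph_unit.comp isLocalHomeomorph_x

theorem inv_mem_piece {g : MarkovGroupoid A} {k l : ℕ} (hg : g ∈ piece A k l) :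
    ArrowGroupoid.inv g ∈ piece A l k :=
  ⟨by change -g.n = _; rw [hg.1]; ring, hg.2.symm⟩

theorem mul_mem_piece {g h : MarkovGroupoid A} (e : ArrowGroupoid.src g = ArrowGroupoid.rng h)
    {k l p q : ℕ} (hg : g ∈ piece A k l) (hh : h ∈ piece A p q) :
    ArrowGroupoid.mul g h e ∈ piece A (k + p) (q + l) := by
  have e' : g.z = h.x := congrArg MarkovGroupoid.x e
  refine ⟨?_, shift_trans hg.2 (e' ▸ hh.2)⟩
  change g.n + h.n = _
  rw [hg.1, hh.1]
  push_cast
  ring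

theorem continuous_inv :
    Continuous (ArrowGroupoid.inv : MarkovGroupoid A → MarkovGroupoid A) := by
  refine continuous_iff_continuousAt.2 fun g ↦ ?_
  obtain ⟨k, l, hg⟩ := exists_mem_piece g
  refine (tendsto_nhds_iff (inv_mem_piece hg)).2 ⟨?_, continuous_z.continuousAt,
    continuous_x.continuousAt⟩
  filter_upwards [(isOpen_piece k l).mem_nhds hg] with h hh using inv_mem_piece hh

theorem continuous_mul :
    Continuous fun p : {p : MarkovGroupoid A × MarkovGroupoid A //
      ArrowGroupoid.src p.1 = ArrowGroupoid.rng p.2} ↦ ArrowGroupoid.mul p.1.1 p.1.2 p.2 := by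
  refine continuous_iff_continuousAt.2 fun p ↦ ?_
  obtain ⟨k, l, hg⟩ := exists_mem_piece p.1.1
  obtain ⟨k', l', hh⟩ := exists_mem_piece p.1.2
  have h1 := continuous_fst.comp (continuous_subtype_val (p := fun p : MarkovGroupoid A ×
    MarkovGroupoid A ↦ ArrowGroupoid.src p.1 = ArrowGroupoid.rng p.2))
  have h2 := continuous_snd.comp (continuous_subtype_val (p := fun p : MarkovGroupoid A ×
    MarkovGroupoid A ↦ ArrowGroupoid.src p.1 = ArrowGroupoid.rng p.2))
  refine (tendsto_nhds_iff (mul_mem_piece p.2 hg hh)).2 ⟨?_, (continuous_x.comp h1).continuousAt,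
    (continuous_z.comp h2).continuousAt⟩
  filter_upwards [h1.continuousAt ((isOpen_piece k l).mem_nhds hg),
    h2.continuousAt ((isOpen_piece k' l').mem_nhds hh)] with q hq hq'
  exact mul_mem_piece q.2 hq hq'

end MarkovGroupoid

/-! ### The cocycle condition -/

namespace MarkovGroupoid

variable {N : ℕ} {A : Matrix (Fin N) (Fin N) ℤ}

/-- If `(p, q)` also represents the arrow, then `k + q = p + l`. Expanding `f^(k+q)` at `x` and
`f^(l+q)` at `z` in two ways each gives `f^k(x) - f^l(z) = f^p(x) - f^q(z)`. -/
theorem mem_cocycleGroupoid_iff {f : C(MarkovShift A, ℤ)} {g : MarkovGroupoid A} {k l : ℕ}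
    (hg : g ∈ piece A k l) :
    g ∈ (cocycleGroupoid A f).carrier ↔ cocycleSum f k g.x = cocycleSum f l g.z := by
  refine ⟨?_, fun h ↦ ⟨k, l, hg.1, hg.2, h⟩⟩
  rintro ⟨p, q, hn, h, hf⟩
  have h1 := cocycleSum_add f k q g.x
  have h2 := cocycleSum_add f p l g.x
  have h3 := cocycleSum_add f l q g.z
  have h4 := cocycleSum_add f q l g.z
  rw [hg.2, show k + q = p + l by have := hg.1; omega] at h1
  rw [h] at h2
  rw [add_comm l q] at h3
  linarith

theorem isClopen_cocycleGroupoid (f : C(MarkovShift A, ℤ)) :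
    IsClopen (cocycleGroupoid A f).carrier := by
  have key : ∀ g : MarkovGroupoid A, ∀ᶠ h in 𝓝 g,
      (h ∈ (cocycleGroupoid A f).carrier ↔ g ∈ (cocycleGroupoid A f).carrier) := by
    intro g
    obtain ⟨k, l, hg⟩ := exists_mem_piece g
    filter_upwards [(isOpen_piece k l).mem_nhds hg,
      ((continuous_cocycleSum f k).comp continuous_x).continuousAt.eventually
        ((isOpen_discrete {cocycleSum f k g.x}).mem_nhds rfl),
      ((continuous_cocycleSum f l).comp continuous_z).continuousAt.eventually
        ((isOpen_discrete {cocycleSum f l g.z}).mem_nhds rfl)] with h hh h1 h2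
    rw [mem_cocycleGroupoid_iff hg, mem_cocycleGroupoid_iff hh]
    have h1' : cocycleSum f k h.x = cocycleSum f k g.x := h1
    have h2' : cocycleSum f l h.z = cocycleSum f l g.z := h2
    rw [h1', h2']
  constructor
  · rw [← isOpen_compl_iff, isOpen_iff_eventually]
    intro g hg
    filter_upwards [key g] with h hh
    rw [mem_compl_iff, hh]
    exact hg
  · rw [isOpen_iff_eventually]
    intro g hg
    filter_upwards [key g] with h hh
    exact hh.2 hg

theorem isEtale : ArrowGroupoid.IsEtale (MarkovGroupoid A) where
  t2 := inferInstance
  locallyCompact := inferInstance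
  continuous_inv := continuous_inv
  continuous_mul := continuous_mul
  isLocalHomeomorph_rng := isLocalHomeomorph_rng

end MarkovGroupoid

/-! ### Open subgroupoids -/

namespace ArrowGroupoid

variable {G : Type u} [ArrowGroupoid G] [TopologicalSpace G]

theorem IsEtale.sub (hG : IsEtale G) {H : Sub G} (hH : IsOpen H.carrier) :
    IsEtale H.carrier where
  t2 := have := hG.t2; inferInstance
  locallyCompact := have := hG.locallyCompact; hH.locallyCompactSpace
  continuous_inv := (hG.continuous_inv.comp continuous_subtype_val).subtype_mk _
  continuous_mul := by
    refine Continuous.subtype_mk ?_ _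
    have h : Continuous fun p : {p : H.carrier × H.carrier // src p.1 = rng p.2} ↦
        (⟨(p.1.1.1, p.1.2.1), congrArg Subtype.val p.2⟩ : {p : G × G // src p.1 = rng p.2}) :=
      Continuous.subtype_mk ((continuous_subtype_val.comp
        (continuous_fst.comp continuous_subtype_val)).prodMk (continuous_subtype_val.comp
        (continuous_snd.comp continuous_subtype_val))) _
    exact hG.continuous_mul.comp h
  isLocalHomeomorph_rng := by
    have hv := hH.isOpenEmbedding_subtypeVal.isLocalHomeomorph
    exact IsLocalHomeomorph.of_comp (g := Subtype.val) (hG.isLocalHomeomorph_rng.comp hv) hv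
      ((hG.isLocalHomeomorph_rng.continuous.comp continuous_subtype_val).subtype_mk _)

theorem IsEssentiallyPrincipal.sub (hG : IsEssentiallyPrincipal G) {H : Sub G}
    (hH : IsOpen H.carrier) : IsEssentiallyPrincipal H.carrier := by
  have h1 : isotropy H.carrier = Subtype.val ⁻¹' isotropy G := by
    ext g; exact Subtype.ext_iff
  have h2 : units H.carrier = Subtype.val ⁻¹' units G := by
    ext g; exact Subtype.ext_iff
  rw [IsEssentiallyPrincipal, h1, h2, ← hG]
  exact (hH.isOpenMap_subtype_val.preimage_interior_eq_interior_preimage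
    continuous_subtype_val _).symm

end ArrowGroupoid

/-! ### Absence of isolated points -/

namespace MarkovShift

variable {N : ℕ} {A : Matrix (Fin N) (Fin N) ℤ}

/-- Follow the first `n` entries of `x` and then those of `y`. -/
def splice (n : ℕ) (x y : MarkovShift A) (h : x.1 n = y.1 0) : MarkovShift A :=
  ⟨fun i ↦ if i < n then x.1 i else y.1 (i - n), fun i ↦ by
    rcases lt_trichotomy (i + 1) n with hi | hi | hi
    · simpa only [hi, show i < n by omega, if_true] using x.2 i
    · subst hi
      simpa [← h] using x.2 i
    · simpa only [show ¬ i + 1 < n by omega, show ¬ i < n by omega, if_false,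
        show i + 1 - n = i - n + 1 by omega] using y.2 (i - n)⟩

theorem splice_of_lt {n : ℕ} {x y : MarkovShift A} (h : x.1 n = y.1 0) {i : ℕ} (hi : i < n) :
    (splice n x y h).1 i = x.1 i := if_pos hi

theorem splice_add {n : ℕ} {x y : MarkovShift A} (h : x.1 n = y.1 0) (i : ℕ) :
    (splice n x y h).1 (i + n) = y.1 i := by
  simp [splice]

theorem exists_succ (hA01 : ∀ i j, A i j = 0 ∨ A i j = 1) (hAirr : A.IsIrreducible)
    (i : Fin N) : ∃ j, A i j = 1 := by
  let : Quiver (Fin N) := A.toQuiver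
  have : ∀ {a b : Fin N} (p : Quiver.Path a b), 0 < p.length → ∃ j, A a j = 1 := by
    intro a b p
    induction p with
    | nil => intro h; simp at h
    | @cons c d q e ih =>
      intro _
      rcases Nat.eq_zero_or_pos q.length with hq | hq
      · obtain rfl := Quiver.Path.eq_of_length_zero q hq
        exact ⟨d, (hA01 _ _).resolve_left e.down.ne'⟩
      · exact ih hq
  obtain ⟨p, hp⟩ := hAirr.connected i i
  exact this p hp

theorem exists_start (hA01 : ∀ i j, A i j = 0 ∨ A i j = 1) (hAirr : A.IsIrreducible)
    (i : Fin N) : ∃ x : MarkovShift A, x.1 0 = i := by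
  choose s hs using exists_succ hA01 hAirr
  refine ⟨⟨fun n ↦ s^[n] i, fun n ↦ ?_⟩, rfl⟩
  simp only [Function.iterate_succ_apply', hs]

/-- The edges of a path from `i` to `j` are prepended, last one first, to a sequence starting at
`j`. -/
theorem exists_start_visiting (hA01 : ∀ i j, A i j = 0 ∨ A i j = 1) (hAirr : A.IsIrreducible)
    (i j : Fin N) : ∃ x : MarkovShift A, x.1 0 = i ∧ ∃ n, x.1 (n + 1) = j := by
  let : Quiver (Fin N) := A.toQuiver
  have key : ∀ {a b : Fin N} (p : Quiver.Path a b), ∀ y : MarkovShift A, y.1 0 = b →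
      ∃ x : MarkovShift A, x.1 0 = a ∧ ∀ m, x.1 (p.length + m) = y.1 m := by
    intro a b p
    induction p with
    | nil => exact fun y hy ↦ ⟨y, hy, fun m ↦ by simp⟩
    | @cons c d q e ih =>
      intro y hy
      obtain ⟨x, hx, hx'⟩ := ih (cons c y (hy ▸ (hA01 _ _).resolve_left e.down.ne')) rfl
      exact ⟨x, hx, fun m ↦ by
        have := hx' (m + 1)
        rw [Quiver.Path.length_cons, show q.length + 1 + m = q.length + (m + 1) by ring, this]
        rfl⟩
  obtain ⟨y, hy⟩ := exists_start hA01 hAirr j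
  obtain ⟨p, hp⟩ := hAirr.connected i j
  obtain ⟨x, hx, hx'⟩ := key p y hy
  refine ⟨x, hx, p.length - 1, ?_⟩
  rw [Nat.sub_add_cancel hp]
  exact (hx' 0).trans hy

/-- The shift space of an irreducible matrix which is no permutation matrix has no isolated
points. -/
theorem exists_mem_cyl_ne (hA01 : ∀ i j, A i j = 0 ∨ A i j = 1) (hAirr : A.IsIrreducible)
    (hAperm : ∀ π : Equiv.Perm (Fin N), A ≠ π.permMatrix ℤ) (n : ℕ) (x : MarkovShift A) :
    ∃ y ∈ cyl n x, y ≠ x := by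
  by_contra! hx
  -- A sequence from `x n` through `j`, spliced into `x` at position `n`, stays in the cylinder and
  -- so equals `x`. The `+ 1` supplies a predecessor of `j`, needed for surjectivity of `s` below.
  have hvisit : ∀ j, ∃ m, x.1 (n + m + 1) = j := by
    intro j
    obtain ⟨y, hy, m, hm⟩ := exists_start_visiting hA01 hAirr (x.1 n) j
    refine ⟨m, ?_⟩
    rw [← hx (splice n x y hy.symm) fun i hi ↦ splice_of_lt _ hi,
      show n + m + 1 = m + 1 + n by ring, splice_add, hm]
  -- Any other successor would let a different sequence branch off inside the cylinder. As `x`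
  -- visits every symbol, every symbol then has a single successor.
  have huniq : ∀ m j, A (x.1 (n + m)) j = 1 → j = x.1 (n + m + 1) := by
    intro m j hj
    obtain ⟨y, hy⟩ := exists_start hA01 hAirr j
    let w := cons (x.1 (n + m)) y (hy ▸ hj)
    have h : (splice (n + m) x w rfl).1 (1 + (n + m)) = w.1 1 := splice_add _ _
    rw [hx (splice (n + m) x w rfl) fun i hi ↦ splice_of_lt _ (by omega)] at h
    rw [show n + m + 1 = 1 + (n + m) by ring, h]
    exact hy.symm
  have huniq' : ∀ i j j', A i j = 1 → A i j' = 1 → j = j' := by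
    intro i j j' h h'
    obtain ⟨m, rfl⟩ := hvisit i
    rw [huniq (m + 1) j h, huniq (m + 1) j' h']
  choose s hs using exists_succ hA01 hAirr
  have hsurj : Function.Surjective s := by
    intro j
    obtain ⟨m, rfl⟩ := hvisit j
    exact ⟨x.1 (n + m), huniq' _ _ _ (hs _) (x.2 _)⟩
  refine hAperm (Equiv.ofBijective s (Finite.surjective_iff_bijective.1 hsurj)) ?_
  ext i j
  rw [Equiv.Perm.permMatrix, PEquiv.toMatrix_toPEquiv_apply, Equiv.ofBijective_apply,
    Pi.single_apply]
  split_ifs with h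
  · exact h ▸ hs i
  · exact (hA01 i j).resolve_right fun h' ↦ h (huniq' _ _ _ h' (hs i))

end MarkovShift

/-! ### Essential principality of `G_A` -/

namespace MarkovGroupoid

variable {N : ℕ} {A : Matrix (Fin N) (Fin N) ℤ}

/-- If `k < l`, the relation `y_i = y_{i-l+k}` recovers all entries with `i ≥ n + l` from earlier
ones, which would make `x` isolated. -/
theorem eq_of_eventually_shift_iterate_eq (hA01 : ∀ i j, A i j = 0 ∨ A i j = 1)
    (hAirr : A.IsIrreducible) (hAperm : ∀ π : Equiv.Perm (Fin N), A ≠ π.permMatrix ℤ)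
    {x : MarkovShift A} {k l : ℕ} (h : ∀ᶠ y in 𝓝 x, shift^[k] y = shift^[l] y) : k = l := by
  wlog hkl : k < l generalizing k l
  · by_contra hne
    exact hne (this (h.mono fun _ ↦ Eq.symm) (by omega)).symm
  exfalso
  obtain ⟨n, hn⟩ := exists_cyl_subset h
  obtain ⟨y, hy, hne⟩ := exists_mem_cyl_ne hA01 hAirr hAperm (n + l) x
  refine hne (Subtype.ext (funext fun i ↦ ?_))
  induction i using Nat.strong_induction_on with
  | _ i ih =>
    rcases lt_or_ge i (n + l) with hi | hi
    · exact hy i hi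
    · have h1 := congrArg (fun w ↦ w.1 (i - l)) (hn fun j hj ↦ hy j (by omega))
      have h2 := congrArg (fun w ↦ w.1 (i - l)) (hn (mem_cyl_self n x))
      simp only [shift_iterate_coord, Nat.sub_add_cancel (show l ≤ i by omega)] at h1 h2
      rw [← h1, ← h2]
      exact ih _ (by omega)

theorem units_eq_piece : ArrowGroupoid.units (MarkovGroupoid A) = piece A 0 0 := by
  ext g
  constructor
  · intro (h : unit g.x = g)
    rw [← h]
    exact ⟨by simp [unit], rfl⟩
  · exact fun h ↦ MarkovGroupoid.ext rfl (by rw [h.1]; rfl) h.2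

/-- Near an interior isotropy arrow in `piece A k l`, the ranges fill an open set on which `σ^k =
σ^l`. This forces `k = l`. -/
theorem isEssentiallyPrincipal (hA01 : ∀ i j, A i j = 0 ∨ A i j = 1)
    (hAirr : A.IsIrreducible) (hAperm : ∀ π : Equiv.Perm (Fin N), A ≠ π.permMatrix ℤ) :
    ArrowGroupoid.IsEssentiallyPrincipal (MarkovGroupoid A) := by
  apply Subset.antisymm
  · intro g hg
    obtain ⟨k, l, hgkl⟩ := exists_mem_piece g
    have hmem : interior (ArrowGroupoid.isotropy (MarkovGroupoid A)) ∩ piece A k l ∈ 𝓝 g :=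
      (isOpen_interior.inter (isOpen_piece k l)).mem_nhds ⟨hg, hgkl⟩
    have hkl : k = l := by
      refine eq_of_eventually_shift_iterate_eq hA01 hAirr hAperm (x := g.x) ?_
      filter_upwards [isLocalHomeomorph_x.isOpenMap.image_mem_nhds hmem]
      rintro _ ⟨h, ⟨hh, hh'⟩, rfl⟩
      have e : unit h.x = unit h.z :=
        interior_subset (s := ArrowGroupoid.isotropy (MarkovGroupoid A)) hh
      replace e : h.x = h.z := congrArg x e
      have := hh'.2
      rwa [← e] at this
    have e : unit g.x = unit g.z :=
      interior_subset (s := ArrowGroupoid.isotropy (MarkovGroupoid A)) hg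
    replace e : g.x = g.z := congrArg x e
    refine MarkovGroupoid.ext rfl ?_ e
    change 0 = g.n
    rw [hgkl.1, hkl, sub_self]
  · refine interior_maximal ?_ (units_eq_piece (A := A) ▸ isOpen_piece 0 0)
    intro g hg
    have := (units_eq_piece (A := A) ▸ hg : g ∈ piece A 0 0).2
    exact congrArg unit this

end MarkovGroupoid

/-! ### Continuous choice of replacement words -/

namespace MarkovShift

variable {N : ℕ} {A : Matrix (Fin N) (Fin N) ℤ}

/-- The points that begin with the word `μ`. -/
def wordSet (A : Matrix (Fin N) (Fin N) ℤ) (μ : List (Fin N)) : Set (MarkovShift A) :=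
  {w | ∀ i (h : i < μ.length), w.1 i = μ[i]}

theorem isClopen_wordSet (μ : List (Fin N)) : IsClopen (wordSet A μ) := by
  have : wordSet A μ = ⋂ i : Fin μ.length, (fun w : MarkovShift A ↦ w.1 i) ⁻¹' {μ[i]} := by
    ext w
    simp only [wordSet, mem_ofPred_eq, mem_iInter, mem_preimage, mem_singleton_iff]
    exact ⟨fun h i ↦ h i i.2, fun h i hi ↦ h ⟨i, hi⟩⟩
  rw [this]
  exact isClopen_iInter_of_finite fun i ↦ (isClopen_discrete _).preimage (continuous_coord i)

theorem injOn_shift_iterate_wordSet (μ : List (Fin N)) :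
    InjOn (shift^[μ.length]) (wordSet A μ) :=
  fun _ hy _ hz h ↦ eq_of_shift_iterate_eq (fun i hi ↦ (hy i hi).trans (hz i hi).symm) h

/-- The points `z` such that `μ z` is in the shift space and `f^{|μ|}(μ z) = c`. -/
def liftable (f : C(MarkovShift A, ℤ)) (c : ℤ) (μ : List (Fin N)) : Set (MarkovShift A) :=
  shift^[μ.length] '' (wordSet A μ ∩ cocycleSum f μ.length ⁻¹' {c})

/-- The shift is both open and, by compactness, closed. Closedness matters too: it makes rejection
of earlier words a locally stable condition. -/
theorem isClopen_liftable (f : C(MarkovShift A, ℤ)) (c : ℤ) (μ : List (Fin N)) :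
    IsClopen (liftable f c μ) := by
  have h := (isClopen_wordSet (A := A) μ).inter
    ((isClopen_discrete {c}).preimage (continuous_cocycleSum f μ.length))
  exact ⟨(h.1.isCompact.image (continuous_shift_iterate _)).isClosed,
    isOpenMap_shift_iterate _ _ h.2⟩

/-- An enumeration of the words. -/
noncomputable def word (N : ℕ) : ℕ → List (Fin N) :=
  (exists_surjective_nat (List (Fin N))).choose

theorem word_surjective (N : ℕ) : Function.Surjective (word N) :=
  (exists_surjective_nat (List (Fin N))).choose_spec

/-- The number of the first word `μ` with `z ∈ liftable f c μ`. -/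
noncomputable def liftIndex (f : C(MarkovShift A, ℤ)) (c : ℤ) (z : MarkovShift A) : ℕ :=
  sInf {m | z ∈ liftable f c (word N m)}

/-- The first word `μ` with `z ∈ liftable f c μ`. -/
noncomputable def liftWord (f : C(MarkovShift A, ℤ)) (c : ℤ) (z : MarkovShift A) :
    List (Fin N) :=
  word N (liftIndex f c z)

theorem mem_liftable_liftWord {f : C(MarkovShift A, ℤ)} {c : ℤ} {z : MarkovShift A}
    {μ : List (Fin N)} (h : z ∈ liftable f c μ) : z ∈ liftable f c (liftWord f c z) := by
  obtain ⟨m, rfl⟩ := word_surjective N μ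
  exact Nat.sInf_mem (s := {m | z ∈ liftable f c (word N m)}) ⟨m, h⟩

/-- The initial word of `x` of length `k` is admissible, so a first admissible word exists. -/
theorem mem_liftable_shift_iterate (f : C(MarkovShift A, ℤ)) (k : ℕ) (x : MarkovShift A) :
    shift^[k] x ∈ liftable f (cocycleSum f k x)
      (liftWord f (cocycleSum f k x) (shift^[k] x)) := by
  refine mem_liftable_liftWord (μ := List.ofFn fun i : Fin k ↦ x.1 i) ⟨x, ⟨?_, ?_⟩, ?_⟩
  · intro i hi
    simp
  · simp
  · simp

theorem eventually_liftWord_eq {f : C(MarkovShift A, ℤ)} {c : ℤ} {z : MarkovShift A}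
    (h : z ∈ liftable f c (liftWord f c z)) : ∀ᶠ z' in 𝓝 z, liftWord f c z' = liftWord f c z := by
  have hlt : ∀ᶠ z' in 𝓝 z, ∀ m < liftIndex f c z, z' ∉ liftable f c (word N m) :=
    (eventually_all_finite (finite_lt_nat _)).2 fun m hm ↦
      (isClopen_liftable f c (word N m)).compl.isOpen.mem_nhds (Nat.notMem_of_lt_sInf hm)
  filter_upwards [hlt, (isClopen_liftable f c _).isOpen.mem_nhds h] with z' h1 h2
  refine congrArg (word N) (le_antisymm (Nat.sInf_le h2) ?_)
  by_contra! h3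
  exact h1 _ h3 (mem_liftable_liftWord h2)

/-- The point `x'` with `x' = μ σ^k(x)` for the first word `μ` such that `f^{|μ|}(x') = f^k(x)`. -/
noncomputable def relift (f : C(MarkovShift A, ℤ)) (k : ℕ) (x : MarkovShift A) :
    MarkovShift A :=
  (mem_liftable_shift_iterate f k x).choose

/-- The length of the word that replaces the first `k` entries of `x` in `relift f k x`. -/
noncomputable def reliftLength (f : C(MarkovShift A, ℤ)) (k : ℕ) (x : MarkovShift A) : ℕ :=
  (liftWord f (cocycleSum f k x) (shift^[k] x)).length

theorem relift_mem_wordSet (f : C(MarkovShift A, ℤ)) (k : ℕ) (x : MarkovShift A) :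
    relift f k x ∈ wordSet A (liftWord f (cocycleSum f k x) (shift^[k] x)) :=
  (mem_liftable_shift_iterate f k x).choose_spec.1.1

theorem cocycleSum_relift (f : C(MarkovShift A, ℤ)) (k : ℕ) (x : MarkovShift A) :
    cocycleSum f (reliftLength f k x) (relift f k x) = cocycleSum f k x :=
  (mem_liftable_shift_iterate f k x).choose_spec.1.2

theorem shift_iterate_relift (f : C(MarkovShift A, ℤ)) (k : ℕ) (x : MarkovShift A) :
    shift^[reliftLength f k x] (relift f k x) = shift^[k] x :=
  (mem_liftable_shift_iterate f k x).choose_spec.2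

theorem eventually_liftWord_shift_iterate_eq (f : C(MarkovShift A, ℤ)) (k : ℕ)
    (x : MarkovShift A) : ∀ᶠ y in 𝓝 x, liftWord f (cocycleSum f k y) (shift^[k] y) =
      liftWord f (cocycleSum f k x) (shift^[k] x) := by
  have h : ∀ᶠ y in 𝓝 x, cocycleSum f k y = cocycleSum f k x :=
    (continuous_cocycleSum f k).continuousAt.eventually
      ((isOpen_discrete {cocycleSum f k x}).mem_nhds rfl)
  filter_upwards [h, (continuous_shift_iterate k).continuousAt.eventually
    (eventually_liftWord_eq (mem_liftable_shift_iterate f k x))] with y h1 h2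
  rw [h1, h2]

/-- The chosen word `μ` is locally constant, and on `wordSet A μ` the injective open map `σ^{|μ|}`
has a continuous local inverse. -/
theorem continuous_relift (f : C(MarkovShift A, ℤ)) (k : ℕ) : Continuous (relift f k) := by
  refine continuous_iff_continuousAt.2 fun x ↦ tendsto_def.2 fun S hS ↦ ?_
  set μ := liftWord f (cocycleSum f k x) (shift^[k] x) with hμ
  have hS' : shift^[μ.length] '' (S ∩ wordSet A μ) ∈ 𝓝 (shift^[k] x) := by
    rw [← shift_iterate_relift f k x]
    exact (isOpenMap_shift_iterate _).image_mem_nhds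
      (inter_mem hS ((isClopen_wordSet μ).isOpen.mem_nhds (relift_mem_wordSet f k x)))
  filter_upwards [(continuous_shift_iterate k).continuousAt hS',
    eventually_liftWord_shift_iterate_eq f k x] with y ⟨w, hw, e⟩ hy
  have h1 := relift_mem_wordSet f k y
  have h2 := shift_iterate_relift f k y
  rw [reliftLength] at h2
  rw [hy] at h1 h2
  have : relift f k y = w := injOn_shift_iterate_wordSet μ h1 hw.2 (h2.trans e.symm)
  rw [mem_preimage, this]
  exact hw.1

/-- All choices are made from the pair `(σ^k x, f^k(x))` alone. -/
theorem relift_congr {f : C(MarkovShift A, ℤ)} {k l : ℕ} {x y : MarkovShift A}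
    (h : shift^[k] x = shift^[l] y) (h' : cocycleSum f k x = cocycleSum f l y) :
    relift f k x = relift f l y ∧ reliftLength f k x = reliftLength f l y := by
  unfold relift reliftLength
  simp only [h, h', and_self]

end MarkovShift

/-! ### The arrows to the replaced points -/

namespace MarkovGroupoid

variable {N : ℕ} {A : Matrix (Fin N) (Fin N) ℤ}

/-- The arrow of `G_{A,f}` from `relift f k x` to `x`. -/
noncomputable def reliftArrow (f : C(MarkovShift A, ℤ)) (k : ℕ) (x : MarkovShift A) :
    (cocycleGroupoid A f).carrier :=
  ⟨⟨x, (k : ℤ) - reliftLength f k x, relift f k x, k, reliftLength f k x, rfl,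
    (shift_iterate_relift f k x).symm⟩,
    k, reliftLength f k x, rfl, (shift_iterate_relift f k x).symm,
    (cocycleSum_relift f k x).symm⟩

theorem continuous_reliftArrow (f : C(MarkovShift A, ℤ)) (k : ℕ) :
    Continuous (reliftArrow f k) := by
  refine Continuous.subtype_mk (continuous_iff_continuousAt.2 fun x ↦ ?_) _
  refine (tendsto_nhds_iff (g := (reliftArrow f k x).1) (k := k) (l := reliftLength f k x)
    ⟨rfl, (shift_iterate_relift f k x).symm⟩).2
    ⟨?_, tendsto_id, (continuous_relift f k).continuousAt⟩
  filter_upwards [eventually_liftWord_shift_iterate_eq f k x] with y hy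
  have : reliftLength f k y = reliftLength f k x := congrArg List.length hy
  rw [← this]
  exact ⟨rfl, (shift_iterate_relift f k y).symm⟩

/-- The range is compact, and it is open because `reliftArrow f k` is a continuous section of the
local homeomorphism `η ↦ η.1.x`. -/
theorem isClopen_range_reliftArrow (f : C(MarkovShift A, ℤ)) (k : ℕ) :
    IsClopen (range (reliftArrow f k)) := by
  refine ⟨(isCompact_range (continuous_reliftArrow f k)).isClosed, ?_⟩
  have hx : IsLocalHomeomorph fun g : (cocycleGroupoid A f).carrier ↦ g.1.x :=
    isLocalHomeomorph_x.comp
      (isClopen_cocycleGroupoid f).isOpen.isOpenEmbedding_subtypeVal.isLocalHomeomorph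
  have hid : IsLocalHomeomorph
      ((fun g : (cocycleGroupoid A f).carrier ↦ g.1.x) ∘ reliftArrow f k) :=
    (Homeomorph.refl _).isOpenEmbedding.isLocalHomeomorph
  exact (hid.of_comp hx (continuous_reliftArrow f k)).isOpenMap.isOpen_range

theorem mem_range_reliftArrow {f : C(MarkovShift A, ℤ)} {k : ℕ}
    {η : (cocycleGroupoid A f).carrier} :
    η ∈ range (reliftArrow f k) ↔ η = reliftArrow f k η.1.x := by
  refine ⟨?_, fun h ↦ ⟨_, h.symm⟩⟩
  rintro ⟨x, rfl⟩
  rfl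

/-- After `j + q` steps from `z` and `j + p` steps from `x`, both the shifted point and the sum of
`f` agree, so the same replacement is chosen. This is the equivariance behind amenability. -/
theorem mul_reliftArrow {f : C(MarkovShift A, ℤ)} {γ : (cocycleGroupoid A f).carrier} {p q : ℕ}
    (hγ : γ.1 ∈ piece A p q) (j : ℕ) :
    ArrowGroupoid.mul γ (reliftArrow f (j + q) γ.1.z) rfl = reliftArrow f (j + p) γ.1.x := by
  have hf := (mem_cocycleGroupoid_iff hγ).1 γ.2
  have h1 : shift^[j + q] γ.1.z = shift^[j + p] γ.1.x := by
    rw [Function.iterate_add_apply, Function.iterate_add_apply, hγ.2]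
  have h2 : cocycleSum f (j + q) γ.1.z = cocycleSum f (j + p) γ.1.x := by
    rw [add_comm j q, add_comm j p, cocycleSum_add, cocycleSum_add, hf, hγ.2]
  obtain ⟨h3, h4⟩ := relift_congr h1 h2
  refine Subtype.ext (MarkovGroupoid.ext rfl ?_ h3)
  change γ.1.n + (((j + q : ℕ) : ℤ) - reliftLength f (j + q) γ.1.z) =
    ((j + p : ℕ) : ℤ) - reliftLength f (j + p) γ.1.x
  rw [hγ.1, h4]
  push_cast
  ring

end MarkovGroupoid

/-! ### An `ℓ¹` estimate for counting functions -/

open Classical in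
theorem hasSum_sum_ite {F : Type*} (b : ℕ → F) (s : Finset ℕ) :
    HasSum (fun η ↦ ∑ k ∈ s, if η = b k then (1 : ℝ) else 0) s.card := by
  have := hasSum_sum (s := s) (f := fun k η ↦ if η = b k then (1 : ℝ) else 0) (a := fun _ ↦ 1)
    fun k _ ↦ hasSum_ite_eq (b k) 1
  simpa using this

open Classical in
/-- The counting functions of two sequences that agree up to a shift are close in `ℓ¹`. -/
theorem tsum_abs_sum_ite_sub_le {F : Type*} {b b' : ℕ → F} {p q : ℕ}
    (h : ∀ k, b' (k + q) = b (k + p)) (n : ℕ) :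
    ∑' η, |(∑ k ∈ Finset.range n, if η = b' k then (1 : ℝ) else 0) -
      ∑ k ∈ Finset.range n, if η = b k then (1 : ℝ) else 0| ≤ 2 * (p + q) := by
  let D : (ℕ → F) → ℕ → F → ℝ := fun b m η ↦ ∑ k ∈ Finset.range m, if η = b k then (1 : ℝ) else 0
  have hD : ∀ (b : ℕ → F) (m : ℕ), HasSum (D b m) m := fun b m ↦ by
    simpa only [Finset.card_range] using hasSum_sum_ite b (Finset.range m)
  have hpos : ∀ b m η, 0 ≤ D b m η := fun b m η ↦
    Finset.sum_nonneg fun k _ ↦ by split_ifs <;> norm_num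
  have hadd : ∀ b m m' η, D b (m + m') η = D b m η + D (fun k ↦ b (k + m)) m' η :=
    fun b m m' η ↦ by
      simp only [D, Finset.sum_range_add, add_comm _ m]
  have hS : HasSum (fun η ↦ D b' q η + D (fun k ↦ b' (k + n)) q η +
      (D b p η + D (fun k ↦ b (k + n)) p η)) (2 * (p + q)) := by
    convert ((hD b' q).add (hD (fun k ↦ b' (k + n)) q)).add
      ((hD b p).add (hD (fun k ↦ b (k + n)) p)) using 1
    ring
  -- The common block of `n` terms, `b'` from index `q` and `b` from index `p`, cancels. Four end
  -- blocks remain, of masses `q`, `q`, `p`, `p`.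
  have hle : ∀ η, |D b' n η - D b n η| ≤ D b' q η + D (fun k ↦ b' (k + n)) q η +
      (D b p η + D (fun k ↦ b (k + n)) p η) := by
    intro η
    have h1 := hadd b' n q η
    have h2 := hadd b' q n η
    have h3 := hadd b n p η
    have h4 := hadd b p n η
    simp only [h] at h2
    rw [add_comm q n] at h2
    rw [add_comm p n] at h4
    have h5 := hpos b' q η
    have h6 := hpos (fun k ↦ b' (k + n)) q η
    have h7 := hpos b p η
    have h8 := hpos (fun k ↦ b (k + n)) p η
    rw [abs_le]
    constructor <;> linarith
  have hsum : Summable fun η ↦ |D b' n η - D b n η| :=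
    Summable.of_nonneg_of_le (fun _ ↦ abs_nonneg _) hle hS.summable
  exact (hsum.tsum_le_tsum hle hS.summable).trans_eq hS.tsum_eq

/-! ### The averages and amenability -/

namespace MarkovGroupoid

variable {N : ℕ} {A : Matrix (Fin N) (Fin N) ℤ}

open Classical in
/-- The average of the indicator functions of the ranges of `reliftArrow f k` for `k ≤ n`. -/
noncomputable def average (f : C(MarkovShift A, ℤ)) (n : ℕ) (η : (cocycleGroupoid A f).carrier) :
    ℝ :=
  ((n : ℝ) + 1)⁻¹ *
    ∑ k ∈ Finset.range (n + 1), if η = reliftArrow f k η.1.x then (1 : ℝ) else 0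

theorem average_nonneg (f : C(MarkovShift A, ℤ)) (n : ℕ) (η : (cocycleGroupoid A f).carrier) :
    0 ≤ average f n η :=
  mul_nonneg (by positivity) (Finset.sum_nonneg fun k _ ↦ by split_ifs <;> norm_num)

theorem continuous_average (f : C(MarkovShift A, ℤ)) (n : ℕ) : Continuous (average f n) := by
  classical
  refine continuous_const.mul (continuous_finsetSum _ fun k _ ↦ ?_)
  have : (fun η : (cocycleGroupoid A f).carrier ↦
      if η = reliftArrow f k η.1.x then (1 : ℝ) else 0) =
      (range (reliftArrow f k)).indicator fun _ ↦ 1 := by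
    ext η
    rw [indicator_apply]
    exact if_congr mem_range_reliftArrow.symm rfl rfl
  have h : Continuous ((range (reliftArrow f k)).indicator fun _ ↦ (1 : ℝ)) :=
    continuous_const.indicator (by simp [(isClopen_range_reliftArrow f k).frontier_eq])
  rw [← this] at h
  convert h

theorem hasCompactSupport_average (f : C(MarkovShift A, ℤ)) (n : ℕ) :
    HasCompactSupport (average f n) := by
  refine HasCompactSupport.intro (K := ⋃ k ∈ Finset.range (n + 1), range (reliftArrow f k))
    ((Finset.range (n + 1)).isCompact_biUnion fun k _ ↦
      isCompact_range (continuous_reliftArrow f k)) fun η hη ↦ ?_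
  refine mul_eq_zero_of_right _ (Finset.sum_eq_zero fun k hk ↦ if_neg fun h ↦ hη ?_)
  exact mem_biUnion hk (mem_range_reliftArrow.2 h)

/-- Each `k ≤ n` contributes exactly one arrow to each range fibre. -/
theorem tsum_average (f : C(MarkovShift A, ℤ)) (n : ℕ) {v : (cocycleGroupoid A f).carrier}
    (hv : v ∈ ArrowGroupoid.units (cocycleGroupoid A f).carrier) :
    ∑' η : {η : (cocycleGroupoid A f).carrier // ArrowGroupoid.rng η = v}, average f n η.1 = 1 := by
  classical
  let b : ℕ → {η : (cocycleGroupoid A f).carrier // ArrowGroupoid.rng η = v} :=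
    fun k ↦ ⟨reliftArrow f k v.1.x, hv⟩
  have hsum := (hasSum_sum_ite b (Finset.range (n + 1))).mul_left ((n : ℝ) + 1)⁻¹
  rw [Finset.card_range, Nat.cast_add_one, inv_mul_cancel₀ (by positivity)] at hsum
  rw [← hsum.tsum_eq]
  refine tsum_congr fun η ↦ ?_
  have hx : η.1.1.x = v.1.x := congrArg (fun g ↦ g.1.x) η.2
  simp only [average, hx, Subtype.ext_iff (a1 := η), b]

theorem tsum_abs_average_sub_le (f : C(MarkovShift A, ℤ)) (n : ℕ)
    {γ : (cocycleGroupoid A f).carrier} {p q : ℕ} (hγ : γ.1 ∈ piece A p q) :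
    ∑' η : {η : (cocycleGroupoid A f).carrier // ArrowGroupoid.rng η = ArrowGroupoid.rng γ},
      |average f n (ArrowGroupoid.mul (ArrowGroupoid.inv γ) η.1
        ((ArrowGroupoid.src_inv γ).trans η.2.symm)) - average f n η.1| ≤
      ((n : ℝ) + 1)⁻¹ * (2 * (p + q)) := by
  classical
  let F := {η : (cocycleGroupoid A f).carrier // ArrowGroupoid.rng η = ArrowGroupoid.rng γ}
  let b : ℕ → F := fun k ↦ ⟨reliftArrow f k γ.1.x, rfl⟩
  -- Since `γ⁻¹ η = ξ` if and only if `η = γ ξ`, the translated average counts the translated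
  -- sequence.
  let b' : ℕ → F := fun k ↦ ⟨ArrowGroupoid.mul γ (reliftArrow f k γ.1.z) rfl, rfl⟩
  have hb : ∀ k, b' (k + q) = b (k + p) := fun k ↦ Subtype.ext (mul_reliftArrow hγ k)
  have hn : (0 : ℝ) ≤ ((n : ℝ) + 1)⁻¹ := by positivity
  refine le_trans (le_of_eq ?_) (mul_le_mul_of_nonneg_left (tsum_abs_sum_ite_sub_le hb (n + 1)) hn)
  rw [← tsum_mul_left]
  refine tsum_congr fun η ↦ ?_
  have hx : η.1.1.x = γ.1.x := congrArg (fun g ↦ g.1.x) η.2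
  conv_rhs => rw [← abs_of_nonneg hn, ← abs_mul, mul_sub]
  congr 2
  · refine congrArg _ (Finset.sum_congr rfl fun k _ ↦ @if_congr _ _ _ (_) (_) _ _ _ _ ?_ rfl rfl)
    rw [Subtype.ext_iff, Subtype.ext_iff, Subtype.ext_iff, MarkovGroupoid.ext_iff,
      MarkovGroupoid.ext_iff]
    change (γ.1.z = γ.1.z ∧ -γ.1.n + η.1.1.n = _ ∧ η.1.1.z = relift f k γ.1.z) ↔
      (η.1.1.x = γ.1.x ∧ η.1.1.n = γ.1.n + _ ∧ η.1.1.z = relift f k γ.1.z)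
    rw [neg_add_eq_iff_eq_add]
    exact ⟨fun h ↦ ⟨hx, h.2⟩, fun h ↦ ⟨rfl, h.2⟩⟩
  · simp only [average, hx, Subtype.ext_iff (a1 := η), b]

theorem isAmenable_cocycleGroupoid (f : C(MarkovShift A, ℤ)) :
    ArrowGroupoid.IsAmenable (cocycleGroupoid A f).carrier := by
  refine ⟨ℕ, inferInstance, inferInstance, inferInstance, average f,
    fun n ↦ ⟨continuous_average f n, hasCompactSupport_average f n, average_nonneg f n⟩,
    fun n v hv ↦ (tsum_average f n hv).le, fun K hK _ ↦ ?_, fun K hK ↦ ?_⟩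
  · rw [Metric.tendstoUniformlyOn_iff]
    refine fun ε hε ↦ Eventually.of_forall fun n v hv ↦ ?_
    rw [tsum_average f n (hK hv), dist_self]
    exact hε
  -- The sets `W M` form an increasing open cover, so compactness of `K` bounds `p + q` uniformly.
  · let W : ℕ → Set (cocycleGroupoid A f).carrier :=
      fun M ↦ {γ | ∃ p q, p + q ≤ M ∧ γ.1 ∈ piece A p q}
    have hW : ∀ M, IsOpen (W M) := fun M ↦ by
      have : W M = ⋃ (p : ℕ) (q : ℕ) (_ : p + q ≤ M), Subtype.val ⁻¹' piece A p q := by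
        ext γ
        simp [W]
      rw [this]
      exact isOpen_iUnion fun p ↦ isOpen_iUnion fun q ↦ isOpen_iUnion fun _ ↦
        (isOpen_piece p q).preimage continuous_subtype_val
    obtain ⟨M, hM⟩ := hK.elim_directed_cover W hW
      (fun γ _ ↦ let ⟨p, q, h⟩ := exists_mem_piece γ.1; mem_iUnion.2 ⟨p + q, p, q, le_rfl, h⟩)
      (Monotone.directed_le fun M M' h γ ⟨p, q, hpq, hγ⟩ ↦ ⟨p, q, hpq.trans h, hγ⟩)
    rw [Metric.tendstoUniformlyOn_iff]
    intro ε hε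
    have hlim : Tendsto (fun n : ℕ ↦ ((n : ℝ) + 1)⁻¹ * (2 * M)) atTop (𝓝 0) := by
      simpa using (tendsto_one_div_add_atTop_nhds_zero_nat (𝕜 := ℝ)).mul_const (2 * (M : ℝ))
    filter_upwards [hlim.eventually_lt_const hε] with n hn γ hγ
    obtain ⟨p, q, hpq, hpiece⟩ := hM hγ
    rw [dist_zero_left, Real.norm_of_nonneg (tsum_nonneg fun _ ↦ abs_nonneg _)]
    refine (tsum_abs_average_sub_le f n hpiece).trans_lt (lt_of_le_of_lt ?_ hn)
    have : (p : ℝ) + q ≤ M := by exact_mod_cast hpq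
    gcongr

end MarkovGroupoid

theorem mainTheorem2 {N : ℕ} (A : Matrix (Fin N) (Fin N) ℤ)
    (hA01 : ∀ i j, A i j = 0 ∨ A i j = 1)
    (hAirr : A.IsIrreducible)
    (hAperm : ∀ π : Equiv.Perm (Fin N), A ≠ π.permMatrix ℤ)
    (f : C(MarkovShift A, ℤ)) :
    IsOpen (cocycleGroupoid A f).carrier ∧
    IsClosed (cocycleGroupoid A f).carrier ∧
    ArrowGroupoid.IsEtale (cocycleGroupoid A f).carrier ∧
    ArrowGroupoid.IsEssentiallyPrincipal (cocycleGroupoid A f).carrier ∧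
    ArrowGroupoid.IsAmenable (cocycleGroupoid A f).carrier :=
  have h := MarkovGroupoid.isClopen_cocycleGroupoid f
  ⟨h.isOpen, h.isClosed, MarkovGroupoid.isEtale.sub h.isOpen,
    (MarkovGroupoid.isEssentiallyPrincipal hA01 hAirr hAperm).sub h.isOpen,
    MarkovGroupoid.isAmenable_cocycleGroupoid f⟩
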